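/- **Theorem (Reduction to a one-parameter family).** Let $n\ge 0$ and let $p\in\mathbb R[x,y]$ be a nonzero polynomial of degree at most $n$ in each variable. Call $p$ *real stable* if $p(z_1,z_2)\neq 0$ for all $z_1,z_2\in\mathbb C$ with $\operatorname{Im} z_1>0$ and $\operatorname{Im} z_2>0$. Call a univariate real polynomial *real-rooted* if it is identically zero or all of its complex roots are real. Let $m$ be the total degree of $p$ and let $p_H(x,y,z)=z^{m}\,p(x/z,y/z)\in\mathbb R[x,y,z]$ be the homogenization of $p$. Then $p$ is real stable if and only if the following two conditions hold: 1. for every $\gamma\in\mathbb R$ the univariate polynomial $q_\gamma(t)=p(\gamma+t,t)\in\mathbb R[t]$ is real-rooted; 2. up to replacing $p$ by $-p$, the univariate polynomial $t\mapsto p_H(t,1-t,0)$ is strictly positive on the interval $(0,1)$; that is, it is either strictly positive on all of $(0,1)$ or strictly negative on all of $(0,1)$. -/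

import Mathlib

/-- A real univariate polynomial is real-rooted if it is zero or all its complex roots are real. -/
def RealRooted (f : Polynomial ℝ) : Prop :=
  f = 0 ∨ ∀ z : ℂ, Polynomial.aeval z f = 0 → z.im = 0

/-- A real polynomial is real stable if it is zero or has no zero all of whose coordinates
lie in the open upper half-plane. -/
def RealStable {σ : Type*} (p : MvPolynomial σ ℝ) : Prop :=
  p = 0 ∨ ∀ z : σ → ℂ, (∀ i, 0 < (z i).im) → MvPolynomial.aeval z p ≠ 0

/-- The univariate polynomial `q_γ(t) = p(γ + t, t)`. -/
noncomputable def diagRestriction (p : MvPolynomial (Fin 2) ℝ) (γ : ℝ) : Polynomial ℝ :=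
  MvPolynomial.aeval ![Polynomial.C γ + Polynomial.X, Polynomial.X] p

/-- The homogenization `p_H(x, y, z) = z ^ m * p(x / z, y / z)` of a bivariate polynomial, where
`m` is the total degree of `p`; the subtraction does not truncate, since `d 0 + d 1 ≤ m` for
every exponent `d` in the support of `p`. -/
noncomputable def homogenization (p : MvPolynomial (Fin 2) ℝ) : MvPolynomial (Fin 3) ℝ :=
  ∑ d ∈ p.support, MvPolynomial.C (p.coeff d) * MvPolynomial.X 0 ^ d 0 * MvPolynomial.X 1 ^ d 1 *
    MvPolynomial.X 2 ^ (p.totalDegree - (d 0 + d 1))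

/-- The explicit sum agrees with the formula `z ^ m * p(x / z, y / z)`. -/
theorem eval_homogenization (p : MvPolynomial (Fin 2) ℝ) (x y z : ℝ) (hz : z ≠ 0) :
    MvPolynomial.eval ![x, y, z] (homogenization p) =
      z ^ p.totalDegree * MvPolynomial.eval ![x / z, y / z] p := by
  rw [MvPolynomial.eval_eq' _ p, homogenization, map_sum, Finset.mul_sum]
  refine Finset.sum_congr rfl fun d hd => ?_
  have h : d 0 + d 1 ≤ p.totalDegree := by
    have := MvPolynomial.le_totalDegree hd
    rwa [Finsupp.sum_fintype _ _ (fun _ => rfl), Fin.sum_univ_two] at this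
  obtain ⟨k, hk⟩ := Nat.exists_eq_add_of_le h
  rw [hk]
  simp [Fin.prod_univ_two, div_pow, pow_add]
  field_simp

/-! Along any line of real direction `(a, b)`, the coefficient of degree `p.totalDegree` is `L(a, b)
= p_H(a, b, 0)`, whatever the base point. Necessity: conjugation gives real-rootedness. If `L`
vanished at a positive direction, `p` would grow too slowly along its imaginary multiples, forcing a
zero nearby, still in the upper half-planes (`RealStable.leadingForm_ne_zero`). Sufficiency:
real-rootedness excludes zeros with equal positive imaginary parts. Deforming the direction `(1, 1)`
through positive directions keeps the degree constant, and a root entering the upper half-plane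
would have to cross the real line, where no root exists (`no_root_upperHalfPlane_of_family`). -/

/-- The univariate polynomial `w ↦ p(x + w a, y + w b)`. -/
noncomputable def lineRestriction (p : MvPolynomial (Fin 2) ℝ) (x y a b : ℂ) : Polynomial ℂ :=
  MvPolynomial.aeval ![Polynomial.C x + Polynomial.C a * Polynomial.X,
    Polynomial.C y + Polynomial.C b * Polynomial.X] p

theorem eval_lineRestriction (p : MvPolynomial (Fin 2) ℝ) (x y a b w : ℂ) :
    (lineRestriction p x y a b).eval w =
      MvPolynomial.aeval ![x + a * w, y + b * w] p := by
  rw [lineRestriction, MvPolynomial.aeval_def, MvPolynomial.aeval_def, MvPolynomial.eval₂_eq',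
    MvPolynomial.eval₂_eq', Polynomial.eval_finsetSum]
  simp [Fin.prod_univ_two]

theorem lineRestriction_eq_sum (p : MvPolynomial (Fin 2) ℝ) (x y a b : ℂ) :
    lineRestriction p x y a b = ∑ d ∈ p.support, Polynomial.C ((p.coeff d : ℝ) : ℂ) *
      ((Polynomial.C x + Polynomial.C a * Polynomial.X) ^ d 0 *
        (Polynomial.C y + Polynomial.C b * Polynomial.X) ^ d 1) := by
  rw [lineRestriction, MvPolynomial.aeval_def, MvPolynomial.eval₂_eq']
  simp [Fin.prod_univ_two]

theorem natDegree_linear_pow_mul_le (x y a b : ℂ) (k l : ℕ) :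
    ((Polynomial.C x + Polynomial.C a * Polynomial.X) ^ k *
        (Polynomial.C y + Polynomial.C b * Polynomial.X) ^ l).natDegree ≤ k + l := by
  compute_degree!

theorem coeff_linear_pow_mul (x y a b : ℂ) (k l : ℕ) :
    ((Polynomial.C x + Polynomial.C a * Polynomial.X) ^ k *
        (Polynomial.C y + Polynomial.C b * Polynomial.X) ^ l).coeff (k + l) = a ^ k * b ^ l := by
  have h (x a : ℂ) : (Polynomial.C x + Polynomial.C a * Polynomial.X).natDegree ≤ 1 := by
    compute_degree!
  have h' (x a : ℂ) (k : ℕ) :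
      ((Polynomial.C x + Polynomial.C a * Polynomial.X) ^ k).natDegree ≤ k := by
    compute_degree!
  have h'' (x a : ℂ) (k : ℕ) :
      ((Polynomial.C x + Polynomial.C a * Polynomial.X) ^ k).coeff k = a ^ k := by
    have := Polynomial.coeff_pow_of_natDegree_le (m := k) (h x a)
    simpa [Polynomial.coeff_C] using this
  rw [Polynomial.coeff_mul_add_eq_of_natDegree_le (h' x a k) (h' y b l), h'', h'']

theorem degree_le_totalDegree {p : MvPolynomial (Fin 2) ℝ} {d : Fin 2 →₀ ℕ} (hd : d ∈ p.support) :
    d 0 + d 1 ≤ p.totalDegree := by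
  have := MvPolynomial.le_totalDegree hd
  rwa [Finsupp.sum_fintype _ _ (fun _ => rfl), Fin.sum_univ_two] at this

theorem natDegree_lineRestriction_le (p : MvPolynomial (Fin 2) ℝ) (x y a b : ℂ) :
    (lineRestriction p x y a b).natDegree ≤ p.totalDegree := by
  rw [lineRestriction_eq_sum]
  refine Polynomial.natDegree_sum_le_of_forall_le _ _ fun d hd => ?_
  exact (Polynomial.natDegree_C_mul_le _ _).trans
    ((natDegree_linear_pow_mul_le x y a b _ _).trans (degree_le_totalDegree hd))

/-- The homogeneous part of degree `p.totalDegree` of `p`, as a function. -/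
noncomputable def leadingForm (p : MvPolynomial (Fin 2) ℝ) (a b : ℝ) : ℝ :=
  MvPolynomial.eval ![a, b, 0] (homogenization p)

theorem leadingForm_eq_sum (p : MvPolynomial (Fin 2) ℝ) (a b : ℝ) :
    leadingForm p a b = ∑ d ∈ p.support,
      if d 0 + d 1 = p.totalDegree then p.coeff d * (a ^ d 0 * b ^ d 1) else 0 := by
  rw [leadingForm, homogenization, map_sum]
  refine Finset.sum_congr rfl fun d hd => ?_
  have h := degree_le_totalDegree hd
  split_ifs with h'
  · simp [h', mul_assoc]
  · have : p.totalDegree - (d 0 + d 1) ≠ 0 := by omega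
    simp [this]

theorem continuous_leadingForm_segment (p : MvPolynomial (Fin 2) ℝ) :
    Continuous fun t : ℝ => leadingForm p t (1 - t) := by
  simp only [leadingForm_eq_sum]
  refine continuous_finsetSum _ fun d _ => ?_
  split_ifs <;> fun_prop

theorem leadingForm_smul (p : MvPolynomial (Fin 2) ℝ) (r a b : ℝ) :
    leadingForm p (r * a) (r * b) = r ^ p.totalDegree * leadingForm p a b := by
  rw [leadingForm_eq_sum, leadingForm_eq_sum, Finset.mul_sum]
  refine Finset.sum_congr rfl fun d _ => ?_
  split_ifs with h
  · rw [← h]; ring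
  · simp

/-- The top homogeneous component is nonzero, hence nonzero as a function on the infinite field `ℝ`.
-/
theorem exists_leadingForm_ne_zero {p : MvPolynomial (Fin 2) ℝ} (hp : p ≠ 0) :
    ∃ a b : ℝ, leadingForm p a b ≠ 0 := by
  obtain ⟨d, hd, hdeg⟩ := Finset.exists_mem_eq_sup p.support
    (MvPolynomial.support_nonempty.2 hp) (fun s : Fin 2 →₀ ℕ => s.sum fun _ e => e)
  have hd' : d.degree = p.totalDegree := by
    rw [MvPolynomial.totalDegree, hdeg]; rfl
  have hne : MvPolynomial.homogeneousComponent p.totalDegree p ≠ 0 := by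
    intro h0
    have := MvPolynomial.coeff_homogeneousComponent p.totalDegree p d
    rw [h0, if_pos hd', MvPolynomial.coeff_zero] at this
    exact MvPolynomial.mem_support_iff.1 hd this.symm
  by_contra! hcon
  refine hne (MvPolynomial.funext fun v => ?_)
  rw [map_zero, ← hcon (v 0) (v 1), leadingForm_eq_sum, MvPolynomial.homogeneousComponent_apply,
    map_sum, Finset.sum_filter]
  refine Finset.sum_congr rfl fun e _ => ?_
  have : e.degree = e 0 + e 1 := by
    rw [Finsupp.degree_eq_sum, Fin.sum_univ_two]
  rw [this]
  split_ifs
  · rw [MvPolynomial.eval_monomial, Finsupp.prod_fintype _ _ (by simp), Fin.prod_univ_two]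
  · rfl

theorem coeff_lineRestriction (p : MvPolynomial (Fin 2) ℝ) (x y : ℂ) (a b : ℝ) :
    (lineRestriction p x y a b).coeff p.totalDegree = leadingForm p a b := by
  rw [lineRestriction_eq_sum, leadingForm_eq_sum, Polynomial.finsetSum_coeff, Complex.ofReal_sum]
  refine Finset.sum_congr rfl fun d hd => ?_
  rw [Polynomial.coeff_C_mul]
  split_ifs with h
  · rw [← h, coeff_linear_pow_mul]
    push_cast
    ring
  · rw [Polynomial.coeff_eq_zero_of_natDegree_lt, mul_zero, Complex.ofReal_zero]
    exact (natDegree_linear_pow_mul_le _ _ _ _ _ _).trans_lt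
      (lt_of_le_of_ne (degree_le_totalDegree hd) h)

theorem natDegree_lineRestriction {p : MvPolynomial (Fin 2) ℝ} (x y : ℂ) {a b : ℝ}
    (h : leadingForm p a b ≠ 0) : (lineRestriction p x y a b).natDegree = p.totalDegree := by
  refine Polynomial.natDegree_eq_of_le_of_coeff_ne_zero (natDegree_lineRestriction_le p x y a b) ?_
  rw [coeff_lineRestriction]
  exact_mod_cast h

theorem continuous_coeff_lineRestriction (p : MvPolynomial (Fin 2) ℝ) (x y : ℂ) {a b : ℝ → ℂ}
    (ha : Continuous a) (hb : Continuous b) (k : ℕ) :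
    Continuous fun s => (lineRestriction p x y (a s) (b s)).coeff k := by
  have hlin (x : ℂ) {a : ℝ → ℂ} (ha : Continuous a) (j : ℕ) : ∀ k, Continuous fun s =>
      ((Polynomial.C x + Polynomial.C (a s) * Polynomial.X) ^ j).coeff k := by
    induction j with
    | zero => intro k; simpa using continuous_const
    | succ j ih =>
      intro k
      simp only [pow_succ, Polynomial.coeff_mul]
      refine continuous_finsetSum _ fun i _ => (ih _).mul ?_
      simp only [Polynomial.coeff_add, Polynomial.coeff_C_mul]
      fun_prop
  simp only [lineRestriction_eq_sum, Polynomial.finsetSum_coeff, Polynomial.coeff_C_mul]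
  simp only [Polynomial.coeff_mul]
  exact continuous_finsetSum _ fun d _ => continuous_const.mul
    (continuous_finsetSum _ fun i _ => (hlin x ha _ _).mul (hlin y hb _ _))

/-! ### Location and continuity of roots -/

/-- A polynomial that is small at `w₀` has a root close to `w₀`. -/
theorem exists_root_near {q : Polynomial ℂ} (hq : 0 < q.natDegree) (w₀ : ℂ) :
    ∃ w, q.eval w = 0 ∧ ‖q.leadingCoeff‖ * ‖w₀ - w‖ ^ q.natDegree ≤ ‖q.eval w₀‖ := by
  have hsp := IsAlgClosed.splits q
  have hq0 : q ≠ 0 := by rintro rfl; simp at hq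
  have hcard : q.roots.card = q.natDegree := hsp.natDegree_eq_card_roots.symm
  have hne : q.roots.toFinset.Nonempty := by
    rw [Multiset.toFinset_nonempty]
    rintro h
    rw [h] at hcard
    simp at hcard
    omega
  -- For the root nearest to `w₀`, every factor of the root product is at least `‖w₀ - w‖`.
  obtain ⟨w, hw, hmin⟩ := Finset.exists_min_image _ (fun w => ‖w₀ - w‖) hne
  refine ⟨w, (Polynomial.mem_roots hq0).1 (Multiset.mem_toFinset.1 hw), ?_⟩
  rw [hsp.eval_eq_prod_roots, norm_mul, ← hcard]
  gcongr
  have key : ∀ s : Multiset ℂ, (∀ v ∈ s, ‖w₀ - w‖ ≤ ‖w₀ - v‖) →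
      ‖w₀ - w‖ ^ s.card ≤ ‖(s.map fun v => w₀ - v).prod‖ := by
    intro s
    induction s using Multiset.induction_on with
    | empty => simp
    | cons v s ih =>
      intro h
      rw [Multiset.card_cons, Multiset.map_cons, Multiset.prod_cons, norm_mul, pow_succ']
      exact mul_le_mul (h v (Multiset.mem_cons_self v s))
        (ih fun u hu => h u (Multiset.mem_cons_of_mem hu)) (by positivity) (norm_nonneg _)
  exact key _ fun v hv => hmin v (Multiset.mem_toFinset.2 hv)

theorem norm_sum_mul_pow_le (c : ℕ → ℂ) (m : ℕ) {w : ℂ} (hw : 1 ≤ ‖w‖) :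
    ‖∑ k ∈ Finset.range (m + 1), c k * w ^ k‖ ≤
      (∑ k ∈ Finset.range (m + 1), ‖c k‖) * ‖w‖ ^ m := by
  rw [Finset.sum_mul]
  refine norm_sum_le_of_le _ fun k hk => ?_
  rw [norm_mul, norm_pow]
  gcongr
  exact Nat.lt_succ_iff.1 (Finset.mem_range.1 hk)

/-- Every root of `q` is bounded by an explicit continuous function of the coefficients. -/
theorem norm_root_le {q : Polynomial ℂ} {m : ℕ} (hm : q.natDegree = m + 1) {w : ℂ}
    (hw : q.eval w = 0) :
    ‖w‖ ≤ 1 + (∑ k ∈ Finset.range (m + 1), ‖q.coeff k‖) / ‖q.coeff (m + 1)‖ := by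
  have hlc : 0 < ‖q.coeff (m + 1)‖ := by
    rw [norm_pos_iff, ← hm]
    refine Polynomial.leadingCoeff_ne_zero.2 ?_
    rintro rfl
    simp at hm
  rcases le_total ‖w‖ 1 with h | h
  · exact h.trans (le_add_of_nonneg_right (by positivity))
  · have hs := Polynomial.eval_eq_sum_range (p := q) w
    rw [hw, hm, Finset.sum_range_succ] at hs
    have h1 : ‖q.coeff (m + 1) * w ^ (m + 1)‖ ≤
        (∑ k ∈ Finset.range (m + 1), ‖q.coeff k‖) * ‖w‖ ^ m := by
      rw [← neg_eq_of_add_eq_zero_right hs.symm, norm_neg]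
      exact norm_sum_mul_pow_le _ m h
    rw [norm_mul, norm_pow, pow_succ', ← mul_assoc] at h1
    have h2 := le_of_mul_le_mul_right h1 (by positivity)
    have h3 : ‖w‖ ≤ (∑ k ∈ Finset.range (m + 1), ‖q.coeff k‖) / ‖q.coeff (m + 1)‖ := by
      rw [le_div_iff₀ hlc]; linarith
    linarith

/-- Roots of a continuous family of polynomials of constant degree cannot enter the upper
half-plane without crossing the real line. -/
theorem no_root_upperHalfPlane_of_family {m : ℕ} {q : ℝ → Polynomial ℂ}
    (hcont : ∀ k, Continuous fun s => (q s).coeff k) (hdeg : ∀ s, (q s).natDegree = m + 1)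
    (hreal : ∀ s w, w.im = 0 → (q s).eval w ≠ 0)
    (hzero : ∀ w : ℂ, 0 < w.im → (q 0).eval w ≠ 0) (s : ℝ) (w : ℂ) (hw : 0 < w.im) :
    (q s).eval w ≠ 0 := by
  have hlc (s : ℝ) : 0 < ‖(q s).coeff (m + 1)‖ := by
    rw [norm_pos_iff, ← hdeg s]
    refine Polynomial.leadingCoeff_ne_zero.2 fun h => ?_
    have := hdeg s
    simp [h] at this
  have heval {Y : Type} [TopologicalSpace Y] {f : Y → ℝ} {g : Y → ℂ} (hf : Continuous f)
      (hg : Continuous g) : Continuous fun y => (q (f y)).eval (g y) := by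
    simp only [Polynomial.eval_eq_sum_range, hdeg]
    exact continuous_finsetSum _ fun k _ => ((hcont k).comp hf).mul (hg.pow k)
  let S : Set ℝ := {s | ∃ w : ℂ, 0 ≤ w.im ∧ (q s).eval w = 0}
  have hclosed : IsClosed S := by
    -- Dividing roots by the bound `B s` puts them in a fixed compact ball, so `S` is the projection
    -- of a closed set along a compact factor.
    let B : ℝ → ℝ := fun s =>
      1 + (∑ k ∈ Finset.range (m + 1), ‖(q s).coeff k‖) / ‖(q s).coeff (m + 1)‖
    have hB : Continuous B := continuous_const.add
      ((continuous_finsetSum _ fun k _ => (hcont k).norm).div (hcont _).norm fun s => (hlc s).ne')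
    have hBpos (s : ℝ) : 0 < B s := by
      have := hlc s
      positivity
    have : CompactSpace (Metric.closedBall (0 : ℂ) 1) :=
      isCompact_iff_compactSpace.1 (isCompact_closedBall _ _)
    let T : Set (ℝ × Metric.closedBall (0 : ℂ) 1) :=
      {z | 0 ≤ (z.2 : ℂ).im ∧ (q z.1).eval ((B z.1 : ℂ) * z.2) = 0}
    have hT : IsClosed T := by
      refine (isClosed_le continuous_const
        (Complex.continuous_im.comp (continuous_subtype_val.comp continuous_snd))).inter
        (isClosed_eq (heval continuous_fst ?_) continuous_const)
      fun_prop
    have hST : S = Prod.fst '' T := by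
      ext s
      constructor
      · rintro ⟨w, hw, h0⟩
        have hb : ‖w‖ ≤ B s := norm_root_le (hdeg s) h0
        have hBne : (B s : ℂ) ≠ 0 := by exact_mod_cast (hBpos s).ne'
        refine ⟨(s, ⟨w / (B s : ℂ), ?_⟩), ⟨?_, ?_⟩, rfl⟩
        · rw [mem_closedBall_zero_iff, norm_div, Complex.norm_real, Real.norm_of_nonneg (hBpos s).le]
          exact (div_le_one (hBpos s)).2 hb
        · simpa [Complex.div_ofReal_im] using div_nonneg hw (hBpos s).le
        · simpa [mul_div_cancel₀ _ hBne] using h0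
      · rintro ⟨⟨s, v⟩, ⟨hv, h0⟩, rfl⟩
        refine ⟨_, ?_, h0⟩
        rw [Complex.im_ofReal_mul]
        exact mul_nonneg (hBpos s).le hv
    rw [hST]
    exact isClosedMap_fst_of_compactSpace _ hT
  have hopen : IsOpen S := by
    rw [isOpen_iff_mem_nhds]
    rintro s ⟨w, hw, h0⟩
    have hw' : 0 < w.im := lt_of_le_of_ne hw fun h => hreal s w h.symm h0
    -- This smallness puts a root of `q t` within `w.im` of `w`, hence above the real line.
    have hev : ∀ᶠ t in nhds s,
        ‖(q t).eval w‖ < ‖(q t).coeff (m + 1)‖ * w.im ^ (m + 1) := by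
      refine (heval continuous_id continuous_const).norm.continuousAt.eventually_lt
        ((hcont (m + 1)).norm.mul continuous_const).continuousAt ?_
      simp only [id, h0, norm_zero]
      exact mul_pos (hlc s) (by positivity)
    filter_upwards [hev] with t ht
    obtain ⟨v, hv, hle⟩ := exists_root_near (q := q t) (by rw [hdeg]; omega) w
    refine ⟨v, ?_, hv⟩
    rw [Polynomial.leadingCoeff, hdeg] at hle
    have h1 := lt_of_mul_lt_mul_left (hle.trans_lt ht) (norm_nonneg _)
    have h2 := lt_of_pow_lt_pow_left₀ _ hw'.le h1
    have h3 := (Complex.abs_im_le_norm (w - v)).trans_lt h2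
    rw [Complex.sub_im, abs_lt] at h3
    linarith
  rcases isClopen_iff.1 ⟨hclosed, hopen⟩ with h | h
  · intro h0
    have : s ∈ S := ⟨w, hw.le, h0⟩
    rw [h] at this
    exact this
  · have : (0 : ℝ) ∈ S := h ▸ Set.mem_univ _
    obtain ⟨v, hv, hv0⟩ := this
    rcases hv.eq_or_lt with h' | h'
    · exact absurd hv0 (hreal 0 v h'.symm)
    · exact absurd hv0 (hzero v h')

/-! ### Necessity -/

theorem aeval_diagRestriction (p : MvPolynomial (Fin 2) ℝ) (γ : ℝ) (z : ℂ) :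
    Polynomial.aeval z (diagRestriction p γ) = MvPolynomial.aeval ![γ + z, z] p := by
  rw [diagRestriction, MvPolynomial.aeval_def, MvPolynomial.aeval_def, MvPolynomial.eval₂_eq',
    MvPolynomial.eval₂_eq', map_sum]
  simp [Fin.prod_univ_two]

theorem RealStable.aeval_ne_zero {p : MvPolynomial (Fin 2) ℝ} (h : RealStable p) (hp : p ≠ 0)
    {z w : ℂ} (hz : 0 < z.im) (hw : 0 < w.im) : MvPolynomial.aeval ![z, w] p ≠ 0 := by
  refine (h.resolve_left hp) _ fun i => ?_
  fin_cases i
  · exact hz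
  · exact hw

theorem RealStable.realRooted_diagRestriction {p : MvPolynomial (Fin 2) ℝ} (h : RealStable p)
    (hp : p ≠ 0) (γ : ℝ) : RealRooted (diagRestriction p γ) := by
  have hup (z : ℂ) (hz : 0 < z.im) : Polynomial.aeval z (diagRestriction p γ) ≠ 0 := by
    rw [aeval_diagRestriction]
    exact h.aeval_ne_zero hp (by simpa using hz) hz
  refine Or.inr fun z hz => ?_
  rcases lt_trichotomy z.im 0 with hlt | heq | hgt
  · refine absurd ?_ (hup (starRingEnd ℂ z) (by simpa using hlt))
    rw [Polynomial.aeval_conj, hz, map_zero]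
  · exact heq
  · exact absurd hz (hup z hgt)

theorem im_add_mul_pos {e f ε T : ℝ} {w : ℂ} (hef : ε * |f| < e) (hT : 0 < T)
    (hw : ‖w‖ ≤ ε * T) : 0 < ((e : ℂ) * (T * Complex.I) + f * w).im := by
  have h1 : |f * w.im| ≤ |f| * (ε * T) := by
    rw [abs_mul]
    gcongr
    exact (Complex.abs_im_le_norm w).trans hw
  have h2 : ε * |f| * T < e * T := by gcongr
  have h3 := neg_abs_le (f * w.im)
  have h4 : ((e : ℂ) * (T * Complex.I) + f * w).im = e * T + f * w.im := by simp
  rw [h4]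
  linarith

theorem RealStable.leadingForm_ne_zero {p : MvPolynomial (Fin 2) ℝ} (h : RealStable p)
    (hp : p ≠ 0) {a b : ℝ} (ha : 0 < a) (hb : 0 < b) : leadingForm p a b ≠ 0 := by
  intro h0
  obtain ⟨c, d, hcd⟩ := exists_leadingForm_ne_zero hp
  obtain hm | ⟨m, hm⟩ : p.totalDegree = 0 ∨ ∃ m, p.totalDegree = m + 1 := by
    cases hm : p.totalDegree <;> simp
  -- In degree `0` the form is constant: scale by `0`, with `0 ^ 0 = 1`.
  · have h1 := leadingForm_smul p 0 c d
    have h2 := leadingForm_smul p 0 a b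
    rw [hm, pow_zero, one_mul, zero_mul, zero_mul] at h1 h2
    exact hcd (by rw [← h1, h2, h0])
  · -- `r` is the restriction of `p` to the line spanned by `(a, b)`; its degree drops
    set r := lineRestriction p 0 0 a b with hr
    have hrm : r.coeff (m + 1) = 0 := by
      rw [hr, ← hm, coeff_lineRestriction, h0, Complex.ofReal_zero]
    have hreval (w : ℂ) : r.eval w = ∑ k ∈ Finset.range (m + 1), r.coeff k * w ^ k := by
      rw [Polynomial.eval_eq_sum_range' (n := m + 2)
        (by have := natDegree_lineRestriction_le p 0 0 a b; rw [← hr] at this; omega),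
        Finset.sum_range_succ, hrm, zero_mul, add_zero]
    set M := ∑ k ∈ Finset.range (m + 1), ‖r.coeff k‖ with hM
    have hM0 : 0 ≤ M := Finset.sum_nonneg fun _ _ => norm_nonneg _
    have hL : 0 < |leadingForm p c d| := abs_pos.2 hcd
    -- `ε` bounds the admissible size of the root relative to the height of the base point
    obtain ⟨ε, hε, hεa, hεb⟩ : ∃ ε : ℝ, 0 < ε ∧ ε * |c| < a ∧ ε * |d| < b := by
      refine ⟨min (a / (|c| + 1)) (b / (|d| + 1)), by positivity, ?_, ?_⟩
      · calc _ ≤ a / (|c| + 1) * |c| := by gcongr; exact min_le_left _ _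
          _ < a := by
            rw [div_mul_eq_mul_div, div_lt_iff₀ (by positivity)]
            nlinarith [abs_nonneg c]
      · calc _ ≤ b / (|d| + 1) * |d| := by gcongr; exact min_le_right _ _
          _ < b := by
            rw [div_mul_eq_mul_div, div_lt_iff₀ (by positivity)]
            nlinarith [abs_nonneg d]
    obtain ⟨K, hK, hKdef⟩ : ∃ K, 0 < K ∧ K = |leadingForm p c d| * ε ^ (m + 1) :=
      ⟨_, by positivity, rfl⟩
    -- At height `T` the value of `p` is at most `M * T ^ m`, which is then below `|L(c, d)| * (ε *
    -- T) ^ (m + 1)`.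
    obtain ⟨T, hT1, hT⟩ : ∃ T, 1 ≤ T ∧ M < K * T := by
      refine ⟨1 + M / K, le_add_of_nonneg_right (by positivity), ?_⟩
      rw [mul_add, mul_one, mul_div_cancel₀ _ hK.ne']
      linarith
    have hT0 : 0 < T := by linarith
    set q := lineRestriction p (a * (T * Complex.I)) (b * (T * Complex.I)) c d with hq
    have hqd : q.natDegree = m + 1 := by rw [hq, natDegree_lineRestriction _ _ hcd, hm]
    have hql : ‖q.leadingCoeff‖ = |leadingForm p c d| := by
      rw [Polynomial.leadingCoeff, hqd, ← hm, hq, coeff_lineRestriction, Complex.norm_real,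
        Real.norm_eq_abs]
    obtain ⟨w, hw0, hw⟩ := exists_root_near (q := q) (by omega) 0
    have hnT : ‖(T : ℂ) * Complex.I‖ = T := by
      simp [abs_of_pos hT0]
    have hq0 : ‖q.eval 0‖ ≤ M * T ^ m := by
      have : q.eval 0 = r.eval (T * Complex.I) := by
        rw [hq, hr, eval_lineRestriction, eval_lineRestriction]
        simp
      rw [this, hreval]
      refine (norm_sum_mul_pow_le _ m (by rw [hnT]; exact hT1)).trans ?_
      rw [hnT]
    rw [hql, hqd, zero_sub, norm_neg] at hw
    have hwT : ‖w‖ < ε * T := by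
      refine lt_of_pow_lt_pow_left₀ (m + 1) (by positivity) ?_
      refine lt_of_mul_lt_mul_left (a := |leadingForm p c d|) ?_ hL.le
      calc _ ≤ M * T ^ m := hw.trans hq0
        _ < K * T * T ^ m := by gcongr
        _ = _ := by rw [hKdef]; ring
    rw [hq, eval_lineRestriction] at hw0
    exact h.aeval_ne_zero hp (im_add_mul_pos hεa hT0 hwT.le)
      (im_add_mul_pos hεb hT0 hwT.le) hw0

theorem RealStable.leadingForm_pos_or_neg {p : MvPolynomial (Fin 2) ℝ} (h : RealStable p)
    (hp : p ≠ 0) :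
    (∀ t ∈ Set.Ioo (0 : ℝ) 1, 0 < leadingForm p t (1 - t)) ∨
      (∀ t ∈ Set.Ioo (0 : ℝ) 1, leadingForm p t (1 - t) < 0) := by
  by_contra! hcon
  obtain ⟨⟨s, hs, hs0⟩, t, ht, ht0⟩ := hcon
  obtain ⟨u, hu, hu0⟩ := isPreconnected_Ioo.intermediate_value hs ht
    (continuous_leadingForm_segment p).continuousOn ⟨hs0, ht0⟩
  exact h.leadingForm_ne_zero hp hu.1 (sub_pos.2 hu.2) hu0

/-! ### Sufficiency -/

theorem leadingForm_ne_zero_of_segment {p : MvPolynomial (Fin 2) ℝ}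
    (h : ∀ t ∈ Set.Ioo (0 : ℝ) 1, leadingForm p t (1 - t) ≠ 0) {a b : ℝ} (ha : 0 < a)
    (hb : 0 < b) : leadingForm p a b ≠ 0 := by
  have hab : 0 < a + b := by positivity
  have h1 := leadingForm_smul p (a + b) (a / (a + b)) (1 - a / (a + b))
  rw [mul_div_cancel₀ _ hab.ne', show (a + b) * (1 - a / (a + b)) = b by field_simp; ring] at h1
  rw [h1]
  exact mul_ne_zero (by positivity)
    (h _ ⟨by positivity, (div_lt_one hab).2 (by linarith)⟩)

/-- The point lies on the diagonal line with `γ = x - y`, at a nonreal parameter; `h1` prevents the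
restriction from vanishing identically. -/
theorem aeval_diagonal_ne_zero {p : MvPolynomial (Fin 2) ℝ}
    (hroot : ∀ γ : ℝ, RealRooted (diagRestriction p γ)) (h1 : leadingForm p 1 1 ≠ 0)
    (x y : ℝ) {z : ℂ} (hz : 0 < z.im) : MvPolynomial.aeval ![x + z, y + z] p ≠ 0 := by
  have key : Polynomial.aeval (y + z) (diagRestriction p (x - y)) =
      MvPolynomial.aeval ![x + z, y + z] p := by
    rw [aeval_diagRestriction]
    congr 3
    push_cast
    ring
  rcases hroot (x - y) with h | h
  · have hzero : lineRestriction p (x - y) 0 (1 : ℝ) (1 : ℝ) = 0 := by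
      refine Polynomial.funext fun w => ?_
      have := aeval_diagRestriction p (x - y) w
      rw [h, map_zero] at this
      simpa [eval_lineRestriction] using this.symm
    have := coeff_lineRestriction p (x - y) 0 1 1
    rw [hzero, Polynomial.coeff_zero] at this
    exact absurd (by exact_mod_cast this.symm) h1
  · intro h0
    have := h (y + z) (key.trans h0)
    simp at this
    exact hz.ne' this

theorem aeval_upperHalfPlane_ne_zero {p : MvPolynomial (Fin 2) ℝ}
    (hroot : ∀ γ : ℝ, RealRooted (diagRestriction p γ))
    (hlead : ∀ a b : ℝ, 0 < a → 0 < b → leadingForm p a b ≠ 0) {z w : ℂ} (hz : 0 < z.im)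
    (hw : 0 < w.im) : MvPolynomial.aeval ![z, w] p ≠ 0 := by
  obtain ⟨α, hα, hα'⟩ : ∃ α, 0 < α ∧ α < min z.im w.im := exists_between (lt_min hz hw)
  obtain ⟨hαz, hαw⟩ := lt_min_iff.1 hα'
  set a := z.im - α with ha
  set b := w.im - α with hb
  have ha0 : 0 < a := sub_pos.2 hαz
  have hb0 : 0 < b := sub_pos.2 hαw
  have h11 := hlead 1 1 one_pos one_pos
  -- The direction runs from `(1, 1)` at `s = 0` to `(a, b)` at `s = 1`, staying positive for all
  -- real `s`; the parameter `I` at `s = 1` gives `(z, w)`.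
  let q : ℝ → Polynomial ℂ := fun s => lineRestriction p (z.re + α * Complex.I)
    (w.re + α * Complex.I) ((a ^ s : ℝ) : ℂ) ((b ^ s : ℝ) : ℂ)
  have hdeg (s : ℝ) : (q s).natDegree = p.totalDegree :=
    natDegree_lineRestriction _ _ (hlead _ _ (by positivity) (by positivity))
  have hlc (s : ℝ) : q s ≠ 0 := by
    intro h
    have := coeff_lineRestriction p (z.re + α * Complex.I) (w.re + α * Complex.I) (a ^ s) (b ^ s)
    change (q s).coeff _ = _ at this
    rw [h, Polynomial.coeff_zero] at this
    exact hlead (a ^ s) (b ^ s) (by positivity) (by positivity) (by exact_mod_cast this.symm)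
  have hqI : (q 1).eval Complex.I = MvPolynomial.aeval ![z, w] p := by
    simp only [q, eval_lineRestriction, Real.rpow_one]
    congr 3
    · apply Complex.ext <;> simp [ha]
    · congr 1
      apply Complex.ext <;> simp [hb]
  rw [← hqI]
  obtain hm | ⟨m, hm⟩ : p.totalDegree = 0 ∨ ∃ m, p.totalDegree = m + 1 := by
    cases hm : p.totalDegree <;> simp
  · obtain ⟨c, hc⟩ := Polynomial.natDegree_eq_zero.1 ((hdeg 1).trans hm)
    rw [← hc, Polynomial.eval_C]
    rintro rfl
    exact hlc 1 (by rw [← hc, map_zero])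
  · refine no_root_upperHalfPlane_of_family (m := m) (fun k => ?_) (fun s => (hdeg s).trans hm)
      (fun s v hv => ?_) (fun v hv => ?_) 1 Complex.I (by simp)
    · exact continuous_coeff_lineRestriction p _ _
        (Complex.continuous_ofReal.comp (Real.continuous_const_rpow ha0.ne'))
        (Complex.continuous_ofReal.comp (Real.continuous_const_rpow hb0.ne')) k
    -- For real `v` both coordinates have imaginary part `α > 0`.
    · have := aeval_diagonal_ne_zero hroot h11 (z.re + a ^ s * v.re) (w.re + b ^ s * v.re)
        (z := α * Complex.I) (by simpa using hα)
      have hv' : v = (v.re : ℂ) := Complex.ext rfl (by simpa using hv)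
      simp only [q, eval_lineRestriction]
      rw [hv']
      convert this using 4
      · push_cast; ring
      · congr 1
        push_cast; ring
    · have := aeval_diagonal_ne_zero hroot h11 z.re w.re (z := α * Complex.I + v)
        (by simpa using add_pos hα hv)
      simp only [q, eval_lineRestriction, Real.rpow_zero]
      simpa [add_assoc] using this

theorem mainTheorem2 (n : ℕ) (p : MvPolynomial (Fin 2) ℝ)
    (hpn : p ∈ MvPolynomial.restrictDegree (Fin 2) ℝ n) (hp : p ≠ 0) :
    RealStable p ↔
      (∀ γ : ℝ, RealRooted (diagRestriction p γ)) ∧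
      ((∀ t ∈ Set.Ioo (0 : ℝ) 1, 0 < MvPolynomial.eval ![t, 1 - t, 0] (homogenization p)) ∨
        (∀ t ∈ Set.Ioo (0 : ℝ) 1, MvPolynomial.eval ![t, 1 - t, 0] (homogenization p) < 0)) := by
  constructor
  · exact fun h => ⟨h.realRooted_diagRestriction hp, h.leadingForm_pos_or_neg hp⟩
  · rintro ⟨hroot, hsign⟩
    have hseg : ∀ t ∈ Set.Ioo (0 : ℝ) 1, leadingForm p t (1 - t) ≠ 0 := fun t ht =>
      hsign.elim (fun h => (h t ht).ne') fun h => (h t ht).ne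
    refine Or.inr fun z hz => ?_
    have hzz : z = ![z 0, z 1] := List.ofFn_inj.1 rfl
    rw [hzz]
    exact aeval_upperHalfPlane_ne_zero hroot
      (fun a b ha hb => leadingForm_ne_zero_of_segment hseg ha hb) (hz 0) (hz 1)
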